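/- **Conventions.** A distributive lattice is non-empty and need not be bounded. An ideal of a lattice is a non-empty lower subset closed under binary joins; a proper ideal $I$ is prime if $a\wedge b\in I$ implies $a\in I$ or $b\in I$. The spectrum $\mathfrak{spec}(L)$ of a distributive lattice $L$ is the set of its prime ideals with the topology having the sets $d(a)=\{I : a\notin I\}$ $(a\in L)$ as a basis. A lattice homomorphism is *proper* if the inverse image of every prime ideal is a prime ideal. $\mathfrak D_p$ is the category of distributive lattices and proper homomorphisms; $\mathfrak D_0$ and $\mathfrak D^1$ are its full subcategories of lattices with a minimum, respectively with a maximum. A subset $A$ of a topological space is *fundamental* if either $A$ is non-empty, open and compact, or $A=\emptyset$ and every non-empty collection of non-empty open compact sets with empty intersection has a finite subcollection with empty intersection. $\mathfrak F(X)$ is the collection of fundamental subsets of $X$. A map is *strongly continuous* if it is continuous and inverse images of fundamental sets are fundamental. A *Balbes–Dwinger space* is a space homeomorphic to $\mathfrak{spec}(L)$ for some distributive lattice $L$; $\mathfrak{BD}$ is the category of these spaces and strongly continuous maps. For such an $X$, $\mathfrak F(X)$ is a sublattice of the power set of $X$. There are contravariant functors $\mathfrak{spec}:\mathfrak D_p\to\mathfrak{BD}$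 and $\mathfrak F:\mathfrak{BD}\to\mathfrak D_p$, acting on morphisms by inverse image. A space is *coherent* if it has a basis of open compact sets closed under finite non-empty intersections; *sober* if every irreducible closed set is the closure of a unique point; *almost-sober* if every proper irreducible closed set is the closure of some point (irreducible sets are non-empty). It is *up-spectral* if it is coherent and sober, and *down-spectral* if it is $T_0$, coherent, compact and almost-sober. (Compact does not include Hausdorff.) **Statement.** A topological space is up-spectral if and only if it is a sober Balbes–Dwinger space, and it is down-spectral if and only if it is a compact Balbes–Dwinger space. Let $\mathfrak{US}$ and $\mathfrak{DS}$ be the full subcategories of $\mathfrak{BD}$ whose objects are the up-spectral, respectively the down-spectral spaces. Then $\mathfrak{spec}$ and $\mathfrak F$ restrict to mutually quasi-inverse contravariant equivalences (i) between $\mathfrak D_0$ and $\mathfrak{US}$, and (ii) between $\mathfrak D^1$ and $\mathfrak{DS}$. -/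

import Mathlib

open CategoryTheory Opposite

universe u

namespace BalbesDwinger

/-! ### Topological notions -/

section Topology

variable {X Y Z : Type u} [TopologicalSpace X] [TopologicalSpace Y] [TopologicalSpace Z]

/-- A nonempty open-compact set. -/
def IsNonemptyOpenCompact (A : Set X) : Prop :=
  A.Nonempty ∧ IsOpen A ∧ IsCompact A

/-- Fundamental subsets: the nonempty open-compact sets, together with the empty set provided that
every nonempty collection of nonempty open-compact sets with empty intersection has a finite
subcollection with empty intersection. -/
def IsFundamental (A : Set X) : Prop :=
  IsNonemptyOpenCompact A ∨
    (A = ∅ ∧ ∀ 𝒜 : Set (Set X), 𝒜.Nonempty → (∀ B ∈ 𝒜, IsNonemptyOpenCompact B) →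
      ⋂₀ 𝒜 = ∅ → ∃ ℬ ⊆ 𝒜, ℬ.Finite ∧ ⋂₀ ℬ = ∅)

/-- A strongly continuous map: continuous, and inverse images of fundamental sets are
fundamental. -/
structure StronglyContinuous (f : X → Y) : Prop where
  continuous : Continuous f
  isFundamental_preimage : ∀ A : Set Y, IsFundamental A → IsFundamental (f ⁻¹' A)

variable (X) in
/-- Coherent: there is a basis of open-compact sets closed under finite (nonempty)
intersections. -/
def IsCoherent : Prop :=
  ∃ B : Set (Set X), TopologicalSpace.IsTopologicalBasis B ∧ (∀ U ∈ B, IsCompact U) ∧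
    ∀ U ∈ B, ∀ V ∈ B, U ∩ V ∈ B

variable (X) in
/-- Sober: every irreducible closed set is the closure of a unique point. -/
def IsSober : Prop :=
  ∀ F : Set X, IsIrreducible F → IsClosed F → ∃! x : X, closure {x} = F

variable (X) in
/-- Almost-sober: every proper irreducible closed set is the closure of some point. -/
def IsAlmostSober : Prop :=
  ∀ F : Set X, IsIrreducible F → IsClosed F → F ≠ Set.univ → ∃ x : X, closure {x} = F

variable (X) in
/-- Up-spectral: coherent and sober. -/
def IsUpSpectral : Prop :=
  IsCoherent X ∧ IsSober X

variable (X) in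
/-- Down-spectral: `T₀`, coherent, compact and almost-sober. -/
def IsDownSpectral : Prop :=
  T0Space X ∧ IsCoherent X ∧ CompactSpace X ∧ IsAlmostSober X

theorem IsNonemptyOpenCompact.preimage_homeomorph (e : X ≃ₜ Y) {A : Set Y}
    (hA : IsNonemptyOpenCompact A) : IsNonemptyOpenCompact (e ⁻¹' A) :=
  ⟨hA.1.preimage e.surjective, hA.2.1.preimage e.continuous, e.isCompact_preimage.2 hA.2.2⟩

theorem IsFundamental.preimage_homeomorph (e : X ≃ₜ Y) {A : Set Y}
    (hA : IsFundamental A) : IsFundamental (e ⁻¹' A) := by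
  rcases hA with hA | ⟨rfl, h⟩
  · exact Or.inl (hA.preimage_homeomorph e)
  · refine Or.inr ⟨Set.preimage_empty, fun 𝒜 hne hA hint => ?_⟩
    have key : ∀ 𝒞 : Set (Set X), ⋂₀ ((fun B => e.symm ⁻¹' B) '' 𝒞) = e.symm ⁻¹' (⋂₀ 𝒞) := by
      intro 𝒞
      ext y
      simp
    obtain ⟨ℬ, hsub, hfin, hem⟩ := h ((fun B => e.symm ⁻¹' B) '' 𝒜) (hne.image _)
      (by rintro _ ⟨B, hB, rfl⟩; exact (hA B hB).preimage_homeomorph e.symm)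
      (by rw [key, hint, Set.preimage_empty])
    obtain ⟨𝒞, hC, hCfin, rfl⟩ :=
      Set.exists_subset_image_finite_and.1 ⟨ℬ, hsub, hfin, (rfl : ℬ = ℬ)⟩
    refine ⟨𝒞, hC, hCfin, ?_⟩
    rw [key] at hem
    have hd := Set.preimage_eq_empty_iff.1 hem
    rw [e.symm.surjective.range_eq] at hd
    exact Set.disjoint_univ.1 hd

theorem StronglyContinuous.id : StronglyContinuous (fun x : X => x) :=
  ⟨continuous_id, fun _ h => h⟩

theorem StronglyContinuous.comp {g : Y → Z} {f : X → Y} (hg : StronglyContinuous g)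
    (hf : StronglyContinuous f) : StronglyContinuous (fun x => g (f x)) :=
  ⟨hg.continuous.comp hf.continuous,
    fun A hA => hf.isFundamental_preimage _ (hg.isFundamental_preimage A hA)⟩

end Topology

/-! ### The prime spectrum of a distributive lattice -/

/-- The points of the spectrum: prime ideals (nonempty, proper) of `L`. -/
@[ext]
structure PrimeSpec (L : Type u) [DistribLattice L] : Type u where
  ideal : Order.Ideal L
  isPrime : ideal.IsPrime

section Spec

variable {L M : Type u} [DistribLattice L] [DistribLattice M]

/-- The basic open set `d a` of all prime ideals not containing `a`. -/
def basicOpen (a : L) : Set (PrimeSpec L) :=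
  {I | a ∉ I.1}

/-- The Zariski (hull-kernel) topology. -/
instance : TopologicalSpace (PrimeSpec L) :=
  TopologicalSpace.generateFrom (Set.range (basicOpen (L := L)))

theorem mem_basicOpen {a : L} {I : PrimeSpec L} : I ∈ basicOpen a ↔ a ∉ I.1 :=
  Iff.rfl

theorem basicOpen_mono {a b : L} (h : a ≤ b) : basicOpen a ⊆ basicOpen b :=
  fun I hI hb => hI (I.1.lower h hb)

theorem basicOpen_sup (a b : L) : basicOpen (a ⊔ b) = basicOpen a ∪ basicOpen b := by
  ext I
  simp only [Set.mem_union, mem_basicOpen, Order.Ideal.sup_mem_iff]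
  tauto

theorem basicOpen_inf (a b : L) : basicOpen (a ⊓ b) = basicOpen a ∩ basicOpen b := by
  refine Set.Subset.antisymm
    (Set.subset_inter (basicOpen_mono inf_le_left) (basicOpen_mono inf_le_right)) ?_
  rintro I ⟨ha, hb⟩ hab
  exact (I.isPrime.mem_or_mem hab).elim ha hb

theorem exists_prime {a b : L} (h : ¬ a ≤ b) : ∃ I : PrimeSpec L, b ∈ I.1 ∧ a ∉ I.1 := by
  have hd : Disjoint (Order.PFilter.principal a : Set L) (Order.Ideal.principal b : Set L) := by
    rw [Set.disjoint_left]
    intro x hx hx'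
    exact h (le_trans (Order.PFilter.mem_principal.1 hx) (Order.Ideal.mem_principal.1 hx'))
  obtain ⟨J, hJ, hle, hdis⟩ := DistribLattice.prime_ideal_of_disjoint_filter_ideal hd
  exact ⟨⟨J, hJ⟩, hle (Order.Ideal.mem_principal_self), Set.disjoint_left.1 hdis
    (Order.PFilter.mem_principal.2 le_rfl)⟩

theorem isBot_of_basicOpen_eq_empty {a : L} (h : basicOpen a = ∅) : IsBot a := by
  intro b
  by_contra hab
  obtain ⟨I, -, hI⟩ := exists_prime hab
  exact (h ▸ (show I ∈ basicOpen a from hI) : I ∈ (∅ : Set (PrimeSpec L)))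

theorem isOpen_basicOpen (a : L) : IsOpen (basicOpen a) :=
  TopologicalSpace.isOpen_generateFrom_of_mem ⟨a, rfl⟩

theorem isTopologicalBasis_basicOpen :
    TopologicalSpace.IsTopologicalBasis (Set.range (basicOpen (L := L))) where
  exists_subset_inter := by
    rintro _ ⟨a, rfl⟩ _ ⟨b, rfl⟩ x hx
    exact ⟨_, ⟨a ⊓ b, rfl⟩, by rwa [basicOpen_inf], (basicOpen_inf a b).le⟩
  sUnion_eq := by
    rw [Set.eq_univ_iff_forall]
    intro I
    obtain ⟨a, ha⟩ := (Set.ne_univ_iff_exists_notMem _).1 I.isPrime.toIsProper.ne_univ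
    exact ⟨_, ⟨a, rfl⟩, ha⟩
  eq_generateFrom := rfl

theorem isCompact_basicOpen (a : L) : IsCompact (basicOpen a) := by
  refine isCompact_generateFrom rfl ?_
  intro P hP hcov
  rcases P.eq_empty_or_nonempty with rfl | ⟨U₀, hU₀⟩
  · exact ⟨∅, Set.Subset.rfl, Set.finite_empty, hcov⟩
  -- the ideal generated by the elements `t` with `d t ∈ P`
  have hI : Order.IsIdeal {x : L | ∃ Q ⊆ P, Q.Finite ∧ basicOpen x ⊆ ⋃₀ Q} := by
    refine ⟨?_, ?_, ?_⟩
    · rintro x y hyx ⟨Q, hQ, hf, hc⟩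
      exact ⟨Q, hQ, hf, (basicOpen_mono hyx).trans hc⟩
    · obtain ⟨t, rfl⟩ := hP hU₀
      exact ⟨t, {basicOpen t}, by simpa using hU₀, Set.finite_singleton _, by simp⟩
    · rintro x ⟨Q, hQ, hf, hc⟩ y ⟨Q', hQ', hf', hc'⟩
      refine ⟨x ⊔ y, ⟨Q ∪ Q', Set.union_subset hQ hQ', hf.union hf', ?_⟩, le_sup_left,
        le_sup_right⟩
      rw [basicOpen_sup, Set.sUnion_union]
      exact Set.union_subset_union hc hc'
  by_contra hcon
  have hd : Disjoint (Order.PFilter.principal a : Set L) (hI.toIdeal : Set L) := by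
    rw [Set.disjoint_left]
    intro x hx hx'
    exact hcon (hI.toIdeal.lower (Order.PFilter.mem_principal.1 hx) hx')
  obtain ⟨J, hJ, hle, hdis⟩ := DistribLattice.prime_ideal_of_disjoint_filter_ideal hd
  have haJ : a ∉ J := Set.disjoint_left.1 hdis (Order.PFilter.mem_principal.2 le_rfl)
  obtain ⟨U, hU, hJU⟩ := hcov (show (⟨J, hJ⟩ : PrimeSpec L) ∈ basicOpen a from haJ)
  obtain ⟨t, rfl⟩ := hP hU
  refine hJU (hle ?_)
  exact ⟨{basicOpen t}, by simpa using hU, Set.finite_singleton _, by simp⟩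

theorem exists_basicOpen_eq {A : Set (PrimeSpec L)} (hA : IsNonemptyOpenCompact A) :
    ∃ a, basicOpen a = A := by
  obtain ⟨hne, hop, hc⟩ := hA
  obtain ⟨t, ht, hAt⟩ := hc.elim_finite_subcover_image (b := {a : L | basicOpen a ⊆ A})
    (c := basicOpen) (fun a _ => isOpen_basicOpen a) (by
      intro x hx
      obtain ⟨_, ⟨a, rfl⟩, hxa, hsub⟩ :=
        isTopologicalBasis_basicOpen.exists_subset_of_mem_open hx hop
      exact Set.mem_iUnion₂.2 ⟨a, hsub, hxa⟩)
  obtain ⟨hfin, hcov⟩ := hAt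
  have key : ∀ s : Set L, s.Finite → s ⊆ {a : L | basicOpen a ⊆ A} →
      s = ∅ ∨ ∃ b : L, basicOpen b ⊆ A ∧ ⋃ i ∈ s, basicOpen i ⊆ basicOpen b := by
    intro s hs
    induction s, hs using Set.Finite.induction_on with
    | empty => exact fun _ => Or.inl rfl
    | @insert x s _ _ ih =>
      intro hsub
      have hx : basicOpen x ⊆ A := hsub (Set.mem_insert _ _)
      right
      rcases ih ((Set.subset_insert _ _).trans hsub) with rfl | ⟨b, hb, hbs⟩
      · exact ⟨x, hx, by simp⟩
      · refine ⟨x ⊔ b, ?_, ?_⟩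
        · rw [basicOpen_sup]
          exact Set.union_subset hx hb
        · rw [basicOpen_sup, Set.biUnion_insert]
          exact Set.union_subset_union_right _ hbs
  rcases key t hfin ht with rfl | ⟨b, hb, htb⟩
  · obtain ⟨x, hx⟩ := hne
    simpa using hcov hx
  · exact ⟨b, hb.antisymm (hcov.trans htb)⟩

theorem isFundamental_empty_of_isBot {b : L} (hb : IsBot b) :
    IsFundamental (∅ : Set (PrimeSpec L)) := by
  refine Or.inr ⟨rfl, fun 𝒜 hne hA hint => ?_⟩
  by_contra! hcon
  have hb0 : basicOpen b = ∅ := by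
    refine Set.eq_empty_of_forall_notMem fun I hI => ?_
    obtain ⟨x, hx⟩ := I.1.nonempty
    exact hI (I.1.lower (hb x) hx)
  have hF : Order.IsPFilter {x : L | ∃ ℬ ⊆ 𝒜, ℬ.Finite ∧ ⋂₀ ℬ ⊆ basicOpen x} := by
    refine Order.IsPFilter.of_def ?_ ?_ ?_
    · obtain ⟨B, hB⟩ := hne
      obtain ⟨x, rfl⟩ := exists_basicOpen_eq (hA B hB)
      exact ⟨x, {basicOpen x}, by simpa using hB, Set.finite_singleton _, by simp⟩
    · rintro x ⟨Q, hQ, hf, hc⟩ y ⟨Q', hQ', hf', hc'⟩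
      refine ⟨x ⊓ y, ⟨Q ∪ Q', Set.union_subset hQ hQ', hf.union hf', ?_⟩, inf_le_left,
        inf_le_right⟩
      rw [basicOpen_inf, Set.sInter_union]
      exact Set.inter_subset_inter hc hc'
    · rintro x y hxy ⟨Q, hQ, hf, hc⟩
      exact ⟨Q, hQ, hf, hc.trans (basicOpen_mono hxy)⟩
  have hd : Disjoint (hF.toPFilter : Set L) (Order.Ideal.principal b : Set L) := by
    rw [Set.disjoint_left]
    rintro x ⟨Q, hQ, hf, hc⟩ hx'
    have hsub : ⋂₀ Q ⊆ ∅ :=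
      hb0 ▸ hc.trans (basicOpen_mono (Order.Ideal.mem_principal.1 hx'))
    exact (hcon Q hQ hf).ne_empty (Set.subset_empty_iff.1 hsub)
  obtain ⟨J, hJ, -, hdis⟩ := DistribLattice.prime_ideal_of_disjoint_filter_ideal hd
  have hmem : (⟨J, hJ⟩ : PrimeSpec L) ∈ ⋂₀ 𝒜 := by
    intro B hB
    obtain ⟨x, rfl⟩ := exists_basicOpen_eq (hA B hB)
    exact Set.disjoint_left.1 hdis
      ⟨{basicOpen x}, by simpa using hB, Set.finite_singleton _, by simp⟩
  rw [hint] at hmem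
  exact hmem

theorem exists_basicOpen_eq_empty [Nonempty L]
    (h : IsFundamental (∅ : Set (PrimeSpec L))) : ∃ a : L, basicOpen a = ∅ := by
  rcases h with h | ⟨-, h⟩
  · exact exists_basicOpen_eq h
  by_contra! hcon
  obtain ⟨ℬ, hsub, hfin, hem⟩ := h (Set.range basicOpen) (Set.range_nonempty _)
    (by rintro _ ⟨a, rfl⟩; exact ⟨hcon a, isOpen_basicOpen a, isCompact_basicOpen a⟩)
    (by
      refine Set.eq_empty_of_forall_notMem fun I hI => ?_
      obtain ⟨x, hx⟩ := I.1.nonempty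
      exact hI _ ⟨x, rfl⟩ hx)
  have key : ∀ s : Set (Set (PrimeSpec L)), s.Finite → s ⊆ Set.range basicOpen →
      ∃ b : L, basicOpen b ⊆ ⋂₀ s := by
    intro s hs
    induction s, hs using Set.Finite.induction_on with
    | empty => exact fun _ => ⟨Classical.arbitrary L, by simp⟩
    | @insert U s _ _ ih =>
      intro hss
      obtain ⟨x, rfl⟩ := hss (Set.mem_insert _ _)
      obtain ⟨b, hb⟩ := ih ((Set.subset_insert _ _).trans hss)
      refine ⟨x ⊓ b, ?_⟩
      rw [basicOpen_inf, Set.sInter_insert]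
      exact Set.inter_subset_inter_right _ hb
  obtain ⟨b, hb⟩ := key ℬ hfin hsub
  rw [hem] at hb
  exact (hcon b).ne_empty (Set.subset_empty_iff.1 hb)

/-- The fundamental subsets of the spectrum are exactly the basic open sets. -/
theorem isFundamental_iff [Nonempty L] {A : Set (PrimeSpec L)} :
    IsFundamental A ↔ ∃ a, basicOpen a = A := by
  constructor
  · intro h
    rcases h with h | ⟨rfl, h⟩
    · exact exists_basicOpen_eq h
    · exact exists_basicOpen_eq_empty (Or.inr ⟨rfl, h⟩)
  · rintro ⟨a, rfl⟩
    rcases (basicOpen a).eq_empty_or_nonempty with h | h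
    · rw [h]
      exact isFundamental_empty_of_isBot (isBot_of_basicOpen_eq_empty h)
    · exact Or.inl ⟨h, isOpen_basicOpen a, isCompact_basicOpen a⟩

/-- A lattice homomorphism is proper if inverse images of prime ideals are prime ideals. -/
def IsProperHom (h : LatticeHom L M) : Prop :=
  ∀ P : Order.Ideal M, P.IsPrime → ∃ Q : Order.Ideal L, Q.IsPrime ∧ (Q : Set L) = h ⁻¹' P

/-- The map `I ↦ h⁻¹(I)` between spectra induced by a proper homomorphism. -/
noncomputable def specMap (h : LatticeHom L M) (hh : IsProperHom h) :
    PrimeSpec M → PrimeSpec L :=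
  fun I => ⟨(hh I.1 I.2).choose, (hh I.1 I.2).choose_spec.1⟩

theorem mem_specMap {h : LatticeHom L M} {hh : IsProperHom h} {I : PrimeSpec M} {a : L} :
    a ∈ (specMap h hh I).1 ↔ h a ∈ I.1 :=
  Set.ext_iff.1 (hh I.1 I.2).choose_spec.2 a

theorem specMap_preimage (h : LatticeHom L M) (hh : IsProperHom h) (a : L) :
    specMap h hh ⁻¹' basicOpen a = basicOpen (h a) :=
  Set.ext fun _ => not_congr mem_specMap

theorem stronglyContinuous_specMap [Nonempty L] [Nonempty M] (h : LatticeHom L M)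
    (hh : IsProperHom h) : StronglyContinuous (specMap h hh) where
  continuous := by
    refine continuous_generateFrom_iff.2 ?_
    rintro _ ⟨a, rfl⟩
    rw [specMap_preimage]
    exact isOpen_basicOpen _
  isFundamental_preimage A hA := by
    obtain ⟨a, rfl⟩ := isFundamental_iff.1 hA
    exact isFundamental_iff.2 ⟨h a, (specMap_preimage h hh a).symm⟩

end Spec

/-! ### Balbes-Dwinger spaces and their lattices of fundamental sets -/

/-- A Balbes-Dwinger space: homeomorphic to the spectrum of a (nonempty) distributive lattice. -/
def IsBalbesDwinger (X : Type u) [TopologicalSpace X] : Prop :=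
  ∃ (L : Type u) (_ : DistribLattice L) (_ : Nonempty L), Nonempty (X ≃ₜ PrimeSpec L)

section Fundamental

variable {X Y : Type u} [TopologicalSpace X] [TopologicalSpace Y]

theorem IsBalbesDwinger.exists_iff (hX : IsBalbesDwinger X) :
    ∃ (L : Type u) (_ : DistribLattice L) (_ : Nonempty L) (e : X ≃ₜ PrimeSpec L),
      ∀ A : Set X, IsFundamental A ↔ ∃ a : L, e ⁻¹' basicOpen a = A := by
  obtain ⟨L, iL, nL, ⟨e⟩⟩ := hX
  refine ⟨L, iL, nL, e, fun A => ⟨fun hA => ?_, ?_⟩⟩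
  · obtain ⟨a, ha⟩ := isFundamental_iff.1 (hA.preimage_homeomorph e.symm)
    refine ⟨a, ?_⟩
    rw [ha, ← Set.preimage_comp]
    simp
  · rintro ⟨a, rfl⟩
    exact (isFundamental_iff.2 ⟨a, rfl⟩).preimage_homeomorph e

/-- The fundamental subsets of a Balbes-Dwinger space, as a sublattice of the power set. -/
def fundamentalSets (X : Type u) [TopologicalSpace X] (hX : IsBalbesDwinger X) :
    Sublattice (Set X) where
  carrier := {A | IsFundamental A}
  supClosed' := by
    obtain ⟨L, iL, nL, e, he⟩ := hX.exists_iff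
    intro A hA B hB
    obtain ⟨a, rfl⟩ := (he A).1 hA
    obtain ⟨b, rfl⟩ := (he B).1 hB
    exact (he _).2 ⟨a ⊔ b, by rw [basicOpen_sup]; rfl⟩
  infClosed' := by
    obtain ⟨L, iL, nL, e, he⟩ := hX.exists_iff
    intro A hA B hB
    obtain ⟨a, rfl⟩ := (he A).1 hA
    obtain ⟨b, rfl⟩ := (he B).1 hB
    exact (he _).2 ⟨a ⊓ b, by rw [basicOpen_inf]; rfl⟩

theorem nonempty_fundamentalSets (hX : IsBalbesDwinger X) : Nonempty (fundamentalSets X hX) := by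
  obtain ⟨L, iL, nL, e, he⟩ := hX.exists_iff
  exact ⟨⟨_, (he _).2 ⟨Classical.arbitrary L, rfl⟩⟩⟩

/-- The homomorphism `A ↦ f⁻¹(A)` between lattices of fundamental sets. -/
def fundMap (hX : IsBalbesDwinger X) (hY : IsBalbesDwinger Y) (f : X → Y)
    (hf : StronglyContinuous f) :
    LatticeHom (fundamentalSets Y hY) (fundamentalSets X hX) where
  toFun A := ⟨f ⁻¹' A.1, hf.isFundamental_preimage A.1 A.2⟩
  map_sup' _ _ := rfl
  map_inf' _ _ := rfl

/-- In a Balbes-Dwinger space, every prime ideal of the lattice of fundamental sets consists of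
the fundamental sets that avoid some point. -/
theorem exists_point (hX : IsBalbesDwinger X) (P : Order.Ideal (fundamentalSets X hX))
    (hP : P.IsPrime) : ∃ x : X, ∀ A : fundamentalSets X hX, A ∈ P ↔ x ∉ A.1 := by
  obtain ⟨L, iL, nL, e, he⟩ := hX.exists_iff
  let δ : L → fundamentalSets X hX := fun a => ⟨e ⁻¹' basicOpen a, (he _).2 ⟨a, rfl⟩⟩
  have hδ : ∀ A : fundamentalSets X hX, ∃ a, δ a = A := fun A => by
    obtain ⟨a, ha⟩ := (he A.1).1 A.2
    exact ⟨a, Subtype.ext ha⟩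
  have hmono : ∀ a b, a ≤ b → δ a ≤ δ b := fun a b h =>
    Set.preimage_mono (basicOpen_mono h)
  have hsup : ∀ a b, δ (a ⊔ b) = δ a ⊔ δ b := fun a b =>
    Subtype.ext (by change e ⁻¹' _ = _; rw [basicOpen_sup]; rfl)
  have hinf : ∀ a b, δ (a ⊓ b) = δ a ⊓ δ b := fun a b =>
    Subtype.ext (by change e ⁻¹' _ = _; rw [basicOpen_inf]; rfl)
  have hI : Order.IsIdeal {a : L | δ a ∈ P} := by
    refine ⟨fun a b hba ha => P.lower (hmono _ _ hba) ha, ?_, ?_⟩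
    · obtain ⟨A, hA⟩ := P.nonempty
      obtain ⟨a, rfl⟩ := hδ A
      exact ⟨a, hA⟩
    · intro a ha b hb
      refine ⟨a ⊔ b, ?_, le_sup_left, le_sup_right⟩
      change δ (a ⊔ b) ∈ P
      rw [hsup]
      exact Order.Ideal.sup_mem ha hb
  have hprop : hI.toIdeal.IsProper := by
    obtain ⟨A, hA⟩ := (Set.ne_univ_iff_exists_notMem _).1 hP.toIsProper.ne_univ
    obtain ⟨a, rfl⟩ := hδ A
    exact Order.Ideal.isProper_of_notMem (p := a) hA
  have hprime : hI.toIdeal.IsPrime := by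
    refine Order.Ideal.IsPrime.of_mem_or_mem ?_
    intro a b hab
    have hab' : δ (a ⊓ b) ∈ P := hab
    rw [hinf] at hab'
    exact hP.mem_or_mem hab'
  refine ⟨e.symm ⟨hI.toIdeal, hprime⟩, fun A => ?_⟩
  obtain ⟨a, rfl⟩ := hδ A
  have h1 : e.symm ⟨hI.toIdeal, hprime⟩ ∈ (δ a).1 ↔ a ∉ hI.toIdeal := by
    change e (e.symm _) ∈ basicOpen a ↔ _
    rw [e.apply_symm_apply]
    rfl
  rw [h1, not_not]
  rfl

/-- Inverse image along a strongly continuous map is a proper homomorphism. -/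
theorem isProperHom_fundMap (hX : IsBalbesDwinger X) (hY : IsBalbesDwinger Y) (f : X → Y)
    (hf : StronglyContinuous f) : IsProperHom (fundMap hX hY f hf) := by
  intro P hP
  obtain ⟨x, hx⟩ := exists_point hX P hP
  have hmem : ∀ A : fundamentalSets Y hY, fundMap hX hY f hf A ∈ P ↔ f x ∉ A.1 :=
    fun A => hx _
  obtain ⟨L, iL, nL, e, he⟩ := hY.exists_iff
  let δ : L → fundamentalSets Y hY := fun a => ⟨e ⁻¹' basicOpen a, (he _).2 ⟨a, rfl⟩⟩
  have hδ : ∀ a, f x ∉ (δ a).1 ↔ a ∈ (e (f x)).1 := fun a => not_not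
  have hI : Order.IsIdeal {A : fundamentalSets Y hY | fundMap hX hY f hf A ∈ P} := by
    refine ⟨fun A B hBA hA => ?_, ?_, ?_⟩
    · exact (hmem B).2 fun h => (hmem A).1 hA (hBA h)
    · obtain ⟨a, ha⟩ := (e (f x)).1.nonempty
      exact ⟨δ a, (hmem _).2 ((hδ a).2 ha)⟩
    · intro A hA B hB
      exact ⟨A ⊔ B, (hmem _).2 fun h => h.elim ((hmem A).1 hA) ((hmem B).1 hB),
        le_sup_left, le_sup_right⟩
  have hprop : hI.toIdeal.IsProper := by
    obtain ⟨a, ha⟩ := (Set.ne_univ_iff_exists_notMem _).1 (e (f x)).2.toIsProper.ne_univ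
    exact Order.Ideal.isProper_of_notMem (p := δ a) fun h => ha ((hδ a).1 ((hmem _).1 h))
  refine ⟨hI.toIdeal, Order.Ideal.IsPrime.of_mem_or_mem ?_, rfl⟩
  intro A B hAB
  by_contra! hcon
  refine (hmem _).1 hAB ⟨?_, ?_⟩
  · by_contra h
    exact hcon.1 ((hmem A).2 h)
  · by_contra h
    exact hcon.2 ((hmem B).2 h)

end Fundamental

/-! ### The categories -/

/-- A (nonempty) distributive lattice. -/
structure DLat : Type (u + 1) where
  carrier : Type u
  [distribLattice : DistribLattice carrier]
  [nonempty : Nonempty carrier]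

attribute [instance] DLat.distribLattice DLat.nonempty

/-- A proper homomorphism of distributive lattices. -/
@[ext]
structure DLat.Hom (L M : DLat.{u}) : Type u where
  hom : LatticeHom L.carrier M.carrier
  isProper : IsProperHom hom

/-- The category of distributive lattices and proper homomorphisms. -/
instance : Category.{u} DLat.{u} where
  Hom := DLat.Hom
  id L := ⟨LatticeHom.id _, fun P hP => ⟨P, hP, rfl⟩⟩
  comp f g := ⟨g.hom.comp f.hom, fun P hP => by
    obtain ⟨Q, hQ, hQP⟩ := g.isProper P hP
    obtain ⟨R, hR, hRQ⟩ := f.isProper Q hQ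
    exact ⟨R, hR, by rw [hRQ, hQP]; rfl⟩⟩

/-- A Balbes-Dwinger space. -/
structure BDSpace : Type (u + 1) where
  carrier : Type u
  [topologicalSpace : TopologicalSpace carrier]
  isBalbesDwinger : IsBalbesDwinger carrier

attribute [instance] BDSpace.topologicalSpace

/-- A strongly continuous map of Balbes-Dwinger spaces. -/
@[ext]
structure BDSpace.Hom (X Y : BDSpace.{u}) : Type u where
  toFun : X.carrier → Y.carrier
  stronglyContinuous : StronglyContinuous toFun

/-- The category of Balbes-Dwinger spaces and strongly continuous maps. -/
instance : Category.{u} BDSpace.{u} where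
  Hom := BDSpace.Hom
  id X := ⟨fun x => x, StronglyContinuous.id⟩
  comp f g := ⟨fun x => g.toFun (f.toFun x), g.stronglyContinuous.comp f.stronglyContinuous⟩

/-- The contravariant functor `L ↦ spec L`, `h ↦ h⁻¹`. -/
noncomputable def specFunctor : DLat.{u}ᵒᵖ ⥤ BDSpace.{u} where
  obj L := ⟨PrimeSpec L.unop.carrier, _, inferInstance, inferInstance, ⟨Homeomorph.refl _⟩⟩
  map h := ⟨specMap h.unop.hom h.unop.isProper, stronglyContinuous_specMap _ _⟩
  map_id L := by
    refine BDSpace.Hom.ext (funext fun I => PrimeSpec.ext (Order.Ideal.ext (Set.ext fun a => ?_)))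
    exact mem_specMap (hh := (𝟙 L.unop : L.unop ⟶ L.unop).isProper)
  map_comp f g := by
    refine BDSpace.Hom.ext (funext fun I => PrimeSpec.ext (Order.Ideal.ext (Set.ext fun a => ?_)))
    exact (mem_specMap (hh := (g.unop ≫ f.unop).isProper)).trans
      ((mem_specMap (hh := g.unop.isProper)).trans (mem_specMap (hh := f.unop.isProper))).symm

/-- The contravariant functor sending `X` to its lattice of fundamental sets, `f ↦ f⁻¹`. -/
def fundFunctor : BDSpace.{u}ᵒᵖ ⥤ DLat.{u} where
  obj X :=
    { carrier := fundamentalSets X.unop.carrier X.unop.isBalbesDwinger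
      nonempty := nonempty_fundamentalSets _ }
  map f := ⟨fundMap _ _ f.unop.toFun f.unop.stronglyContinuous, isProperHom_fundMap _ _ _ _⟩
  map_id _ := rfl
  map_comp _ _ := rfl

/-- Distributive lattices with minimum, inside all distributive lattices. -/
def latWithMin : ObjectProperty DLat.{u} := fun L => ∃ a : L.carrier, IsBot a

/-- Distributive lattices with maximum, inside all distributive lattices. -/
def latWithMax : ObjectProperty DLat.{u} := fun L => ∃ a : L.carrier, IsTop a

/-- Up-spectral spaces, inside all Balbes-Dwinger spaces. -/
def upSpectral : ObjectProperty BDSpace.{u} := fun X => IsUpSpectral X.carrier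

/-- Down-spectral spaces, inside all Balbes-Dwinger spaces. -/
def downSpectral : ObjectProperty BDSpace.{u} := fun X => IsDownSpectral X.carrier

end BalbesDwinger

/-!
The functors `spec` and `𝔉` are quasi-inverse on all of `𝔇_p` and `𝔅𝔇`, and the two equivalences
are restrictions of this duality (`specFundEquivalence`). Its unit is `a ↦ d a`: this is an order
isomorphism of `L` onto `𝔉(spec L)` because prime ideals separate elements and the fundamental sets
of `spec L` are exactly the sets `d a`. Its counit sends a point `x` of `X` to the prime ideal of the
fundamental sets avoiding `x`; it is a homeomorphism by `homeomorphPrimeSpec`, since the fundamental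
sets form a basis and every prime ideal of `𝔉(X)` comes from a point.

To see which objects correspond, let `C` be an irreducible closed subset of `spec L`. The elements
`b` with `d b` disjoint from `C` form a prime ideal, the generic point of `C`, except that this ideal
may be empty. It is nonempty if `C` is not the whole space, so spectra are almost-sober
(`isAlmostSober_primeSpec`), and always if `L` has a minimum. If `L` has no minimum, then no `d a` is
empty, the whole spectrum is irreducible, and it has no generic point. Hence `spec L` is sober
if and only if `L` has a minimum (`isSober_primeSpec_iff`). Likewise `spec L` is compact if and only
if `L` has a maximum.

Conversely, let a `T₀` space have a basis `S` of compact open sets that is a lattice. A prime ideal of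
`S` is recovered, by compactness, from the complement of its union, which is irreducible, so a generic
point of that set represents the ideal (`exists_point_of_isIrreducible`). For an up-spectral space
`S` consists of all compact open sets. A down-spectral space that is not sober is irreducible with no
generic point, and there `S` consists of the nonempty compact open sets: these are closed under
intersection by irreducibility, and every point avoids one of them because it is not generic.
-/

namespace BalbesDwinger

/-! ### Irreducible closed sets and bases -/

section Topology

variable {X Y : Type u} [TopologicalSpace X] [TopologicalSpace Y]

/-- Genericity of a point of a closed set `C` is a condition on basic open sets only. On a spectrum
it says that the prime ideal of the point consists of the `a` with `d a` disjoint from `C`. -/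
theorem closure_singleton_eq_iff {B : Set (Set X)} (hB : TopologicalSpace.IsTopologicalBasis B)
    {C : Set X} (hC : IsClosed C) {x : X} :
    closure {x} = C ↔ ∀ A ∈ B, x ∈ A ↔ (A ∩ C).Nonempty := by
  constructor
  · rintro rfl A hA
    rw [Set.inter_comm, closure_inter_open_nonempty_iff (hB.isOpen hA),
      Set.singleton_inter_nonempty]
  · intro h
    ext y
    conv_rhs => rw [← hC.closure_eq]
    rw [hB.mem_closure_iff, hB.mem_closure_iff]
    refine forall₃_congr fun A hA _ => ?_
    rw [Set.inter_singleton_nonempty, h A hA]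

theorem IsSober.t0Space (h : IsSober X) : T0Space X :=
  ⟨fun x _ hxy => (h (closure {x}) isIrreducible_singleton.closure isClosed_closure).unique rfl
    (inseparable_iff_closure_eq.1 hxy).symm⟩

theorem isSober_of_exists [T0Space X]
    (h : ∀ F : Set X, IsIrreducible F → IsClosed F → ∃ x : X, closure {x} = F) : IsSober X := by
  intro F hF hc
  obtain ⟨x, hx⟩ := h F hF hc
  exact ⟨x, hx, fun y hy => (inseparable_iff_closure_eq.2 (hy.trans hx.symm)).eq⟩

theorem exists_closure_singleton_eq_of_homeomorph (e : X ≃ₜ Y) {F : Set X}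
    (h : ∃ y : Y, closure {y} = e '' F) : ∃ x : X, closure {x} = F := by
  obtain ⟨y, hy⟩ := h
  refine ⟨e.symm y, e.injective.image_injective ?_⟩
  rw [e.image_closure, Set.image_singleton, e.apply_symm_apply, hy]

theorem IsSober.of_homeomorph (e : X ≃ₜ Y) (h : IsSober Y) : IsSober X := by
  have := h.t0Space
  have : T0Space X := e.symm.t0Space
  refine isSober_of_exists fun F hF hc => exists_closure_singleton_eq_of_homeomorph e ?_
  exact (h _ (hF.image e e.continuous.continuousOn) (e.isClosed_image.2 hc)).exists

theorem IsAlmostSober.of_homeomorph (e : X ≃ₜ Y) (h : IsAlmostSober Y) : IsAlmostSober X := by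
  refine fun F hF hc hne => exists_closure_singleton_eq_of_homeomorph e ?_
  refine h _ (hF.image e e.continuous.continuousOn) (e.isClosed_image.2 hc) fun hu => hne ?_
  rw [← Set.preimage_image_eq F e.injective, hu, Set.preimage_univ]

theorem IsCoherent.of_homeomorph (e : X ≃ₜ Y) (h : IsCoherent Y) : IsCoherent X := by
  obtain ⟨B, hB, hc, hi⟩ := h
  refine ⟨Set.preimage e '' B, hB.isInducing e.isInducing, ?_, ?_⟩
  · rintro _ ⟨U, hU, rfl⟩
    exact e.isCompact_preimage.2 (hc U hU)
  · rintro _ ⟨U, hU, rfl⟩ _ ⟨V, hV, rfl⟩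
    exact ⟨U ∩ V, hi U hU V hV, rfl⟩

/-- A compact open set is a finite union of members of the given basis, so stability of that basis
under intersections passes to all compact open sets. -/
theorem IsCoherent.isCompact_inter (h : IsCoherent X) {U V : Set X} (hU : IsOpen U)
    (hUc : IsCompact U) (hV : IsOpen V) (hVc : IsCompact V) : IsCompact (U ∩ V) := by
  obtain ⟨B, hB, hc, hi⟩ := h
  rw [← Subtype.range_coe (s := B)] at hB
  obtain ⟨s, hs, rfl⟩ := eq_finite_iUnion_of_isTopologicalBasis_of_isCompact_open _ hB U hUc hU
  obtain ⟨t, ht, rfl⟩ := eq_finite_iUnion_of_isTopologicalBasis_of_isCompact_open _ hB V hVc hV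
  rw [Set.iUnion₂_inter]
  simp only [Set.inter_iUnion]
  exact hs.isCompact_biUnion fun A _ => ht.isCompact_biUnion fun A' _ =>
    hc _ (hi _ A.2 _ A'.2)

/-! ### Spaces represented by a sublattice of open sets -/

/-- The prime ideal of the members of `S` that avoid the point `x`. -/
def avoidingIdeal (S : Sublattice (Set X)) (x : X) (h : ∃ A ∈ S, x ∉ A) (h' : ∃ A ∈ S, x ∈ A) :
    PrimeSpec S :=
  have hI : Order.IsIdeal {A : S | x ∉ A.1} := by
    refine ⟨fun A B hBA hA hB => hA (hBA hB), ?_, fun A hA B hB => ?_⟩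
    · obtain ⟨A, hA, hx⟩ := h
      exact ⟨⟨A, hA⟩, hx⟩
    · exact ⟨A ⊔ B, fun hAB => hAB.elim hA hB, le_sup_left, le_sup_right⟩
  have hprop : hI.toIdeal.IsProper := by
    obtain ⟨A, hA, hx⟩ := h'
    exact Order.Ideal.isProper_of_notMem (p := ⟨A, hA⟩) fun h => h hx
  ⟨hI.toIdeal, Order.Ideal.IsPrime.of_mem_or_mem fun {A B} hAB => by
    by_contra! hcon
    exact hAB ⟨not_not.1 hcon.1, not_not.1 hcon.2⟩⟩

/-- A `T₀` space with a sublattice `S` of open sets as basis is the spectrum of `S` as soon as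
every point is avoided by some member of `S` and every prime ideal of `S` comes from a point. -/
noncomputable def homeomorphPrimeSpec [T0Space X] (S : Sublattice (Set X))
    (hS : TopologicalSpace.IsTopologicalBasis (S : Set (Set X)))
    (hav : ∀ x : X, ∃ A ∈ S, x ∉ A)
    (hpt : ∀ P : PrimeSpec S, ∃ x : X, ∀ A : S, A ∈ P.1 ↔ x ∉ A.1) : X ≃ₜ PrimeSpec S :=
  have hcov : ∀ x : X, ∃ A ∈ S, x ∈ A := fun x => by
    obtain ⟨A, hA, hx, -⟩ := hS.exists_subset_of_mem_open (Set.mem_univ x) isOpen_univ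
    exact ⟨A, hA, hx⟩
  let f : X → PrimeSpec S := fun x => avoidingIdeal S x (hav x) (hcov x)
  have hpre : ∀ A : S, f ⁻¹' basicOpen A = A.1 := fun _ => Set.ext fun _ => not_not
  have hind : Topology.IsInducing f := by
    refine ⟨hS.eq_generateFrom.trans ?_⟩
    change _ = TopologicalSpace.induced f (TopologicalSpace.generateFrom _)
    rw [induced_generateFrom_eq]
    congr 1
    ext A
    simp [hpre]
  (Equiv.ofBijective f ⟨hind.injective, fun P => (hpt P).imp fun _ hx =>
    PrimeSpec.ext (Order.Ideal.ext (Set.ext fun A => (hx A).symm))⟩).toHomeomorphOfIsInducing hind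

/-- A prime ideal of a lattice of compact open sets is determined by the complement of its union,
an irreducible closed set; a generic point of that set represents the ideal. -/
theorem exists_point_of_isIrreducible (S : Sublattice (Set X))
    (hS : TopologicalSpace.IsTopologicalBasis (S : Set (Set X))) (hc : ∀ A ∈ S, IsCompact A)
    (hgen : ∀ C : Set X, IsIrreducible C → IsClosed C → (∃ A ∈ S, A ∩ C = ∅) →
      ∃ x, closure {x} = C)
    (P : PrimeSpec S) : ∃ x : X, ∀ A : S, A ∈ P.1 ↔ x ∉ A.1 := by
  let C : Set X := (⋃ B ∈ P.1, (B : S).1)ᶜ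
  have hopen : ∀ A : S, IsOpen A.1 := fun A => hS.isOpen A.2
  have hclosed : IsClosed C :=
    (isOpen_biUnion fun B _ => hopen B).isClosed_compl
  have hmem : ∀ A : S, A ∈ P.1 ↔ ¬ (A.1 ∩ C).Nonempty := by
    intro A
    rw [Set.inter_compl_nonempty_iff, not_not]
    refine ⟨fun h => Set.subset_biUnion_of_mem (u := fun B : S => B.1) h, fun h => ?_⟩
    have : Nonempty {B // B ∈ P.1} := P.1.nonempty.to_subtype
    replace h : A.1 ⊆ ⋃ B : {B // B ∈ P.1}, B.1.1 := by rwa [Set.iUnion_subtype]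
    obtain ⟨⟨B, hB⟩, hAB⟩ := (hc A A.2).elim_directed_cover
      (fun B : {B // B ∈ P.1} => B.1.1) (fun B => hopen B.1) h
      (by
        rintro ⟨B, hB⟩ ⟨D, hD⟩
        exact ⟨⟨B ⊔ D, Order.Ideal.sup_mem hB hD⟩, Set.subset_union_left,
          Set.subset_union_right⟩)
    exact P.1.lower hAB hB
  have hirr : IsIrreducible C := by
    constructor
    · obtain ⟨A, hA⟩ := (Set.ne_univ_iff_exists_notMem _).1 P.isPrime.toIsProper.ne_univ
      exact (not_not.1 (mt (hmem A).2 hA)).right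
    · rintro U V hU hV ⟨y, hyC, hyU⟩ ⟨z, hzC, hzV⟩
      obtain ⟨A, hA, hyA, hAU⟩ := hS.exists_subset_of_mem_open hyU hU
      obtain ⟨B, hB, hzB, hBV⟩ := hS.exists_subset_of_mem_open hzV hV
      have hAP : (⟨A, hA⟩ : S) ∉ P.1 := fun h => (hmem _).1 h ⟨y, hyA, hyC⟩
      have hBP : (⟨B, hB⟩ : S) ∉ P.1 := fun h => (hmem _).1 h ⟨z, hzB, hzC⟩
      have hABP : (⟨A, hA⟩ ⊓ ⟨B, hB⟩ : S) ∉ P.1 := fun h =>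
        (P.isPrime.mem_or_mem h).elim hAP hBP
      obtain ⟨w, hw, hwC⟩ := not_not.1 (mt (hmem _).2 hABP)
      exact ⟨w, hwC, hAU hw.1, hBV hw.2⟩
  obtain ⟨A, hA⟩ := P.1.nonempty
  obtain ⟨x, hx⟩ := hgen C hirr hclosed
    ⟨A.1, A.2, Set.not_nonempty_iff_eq_empty.1 ((hmem A).1 hA)⟩
  refine ⟨x, fun A => ?_⟩
  rw [hmem A, (closure_singleton_eq_iff hS hclosed).1 hx A.1 A.2]

/-- Only irreducible closed sets disjoint from some member of `S` need generic points, because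
prime ideals are nonempty. -/
theorem IsBalbesDwinger.of_sublattice [T0Space X] (S : Sublattice (Set X))
    (hS : TopologicalSpace.IsTopologicalBasis (S : Set (Set X))) (hc : ∀ A ∈ S, IsCompact A)
    (hne : (S : Set (Set X)).Nonempty) (hav : ∀ x : X, ∃ A ∈ S, x ∉ A)
    (hgen : ∀ C : Set X, IsIrreducible C → IsClosed C → (∃ A ∈ S, A ∩ C = ∅) →
      ∃ x, closure {x} = C) : IsBalbesDwinger X :=
  ⟨S, inferInstance, hne.to_subtype,
    ⟨homeomorphPrimeSpec S hS hav (exists_point_of_isIrreducible S hS hc hgen)⟩⟩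

theorem IsCoherent.isTopologicalBasis (h : IsCoherent X) :
    TopologicalSpace.IsTopologicalBasis {A : Set X | IsOpen A ∧ IsCompact A} := by
  obtain ⟨B, hB, hc, -⟩ := h
  exact hB.of_isOpen_of_subset (fun A hA => hA.1) fun A hA => ⟨hB.isOpen hA, hc A hA⟩

/-- The compact open sets, including `∅`, represent an up-spectral space. -/
theorem IsUpSpectral.isBalbesDwinger (h : IsUpSpectral X) : IsBalbesDwinger X := by
  have := h.2.t0Space
  let S : Sublattice (Set X) :=
    { carrier := {A | IsOpen A ∧ IsCompact A}
      supClosed' := fun A hA B hB => ⟨hA.1.union hB.1, hA.2.union hB.2⟩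
      infClosed' := fun A hA B hB =>
        ⟨hA.1.inter hB.1, h.1.isCompact_inter hA.1 hA.2 hB.1 hB.2⟩ }
  have h0 : ∅ ∈ S := ⟨isOpen_empty, isCompact_empty⟩
  exact .of_sublattice S h.1.isTopologicalBasis (fun A hA => hA.2) ⟨∅, h0⟩
    (fun x => ⟨∅, h0, Set.notMem_empty x⟩) fun C hC hCc _ => (h.2 C hC hCc).exists

/-- When the space is not sober, the whole space is irreducible without a generic point; then the
nonempty compact open sets form a lattice that represents it. -/
theorem IsDownSpectral.isBalbesDwinger (h : IsDownSpectral X) : IsBalbesDwinger X := by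
  obtain ⟨h0, hcoh, -, has⟩ := h
  by_cases hs : IsSober X
  · exact IsUpSpectral.isBalbesDwinger ⟨hcoh, hs⟩
  obtain ⟨hirr, hgen⟩ : IsIrreducible (Set.univ : Set X) ∧ ∀ x : X, closure {x} ≠ Set.univ := by
    by_contra hcon
    refine hs (isSober_of_exists fun F hF hc => ?_)
    by_cases hu : F = Set.univ
    · subst hu
      by_contra! hx
      exact hcon ⟨hF, hx⟩
    · exact has F hF hc hu
  let S : Sublattice (Set X) :=
    { carrier := {A | IsNonemptyOpenCompact A}
      supClosed' := fun A hA B hB =>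
        ⟨hA.1.mono Set.subset_union_left, hA.2.1.union hB.2.1, hA.2.2.union hB.2.2⟩
      infClosed' := fun A hA B hB =>
        ⟨by simpa using hirr.2 A B hA.2.1 hB.2.1 (by simpa using hA.1) (by simpa using hB.1),
          hA.2.1.inter hB.2.1, hcoh.isCompact_inter hA.2.1 hA.2.2 hB.2.1 hB.2.2⟩ }
  have hsub : ∀ (x : X) (U : Set X), x ∈ U → IsOpen U → ∃ A ∈ S, x ∈ A ∧ A ⊆ U := by
    intro x U hx hU
    obtain ⟨A, hA, hxA, hAU⟩ := hcoh.isTopologicalBasis.exists_subset_of_mem_open hx hU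
    exact ⟨A, ⟨⟨x, hxA⟩, hA⟩, hxA, hAU⟩
  refine .of_sublattice S
    (TopologicalSpace.isTopologicalBasis_of_isOpen_of_nhds (fun A hA => hA.2.1) hsub)
    (fun A hA => hA.2.2) ?_ ?_ ?_
  · obtain ⟨x, -⟩ := hirr.1
    obtain ⟨A, hA, -⟩ := hsub x Set.univ (Set.mem_univ x) isOpen_univ
    exact ⟨A, hA⟩
  · intro x
    obtain ⟨y, hy⟩ := (Set.ne_univ_iff_exists_notMem _).1 (hgen x)
    obtain ⟨A, hA, -, hAx⟩ := hsub y _ hy isClosed_closure.isOpen_compl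
    exact ⟨A, hA, fun hx => hAx hx (subset_closure rfl)⟩
  · rintro C hC hCc ⟨A, hA, hAC⟩
    refine has C hC hCc ?_
    rintro rfl
    exact hA.1.ne_empty (by simpa using hAC)

end Topology
/-! ### Topology of the prime spectrum -/

section Spec

variable {L : Type u} [DistribLattice L]

instance : T0Space (PrimeSpec L) :=
  ⟨fun _ _ h => PrimeSpec.ext (Order.Ideal.ext (Set.ext fun a =>
    not_iff_not.1 (h.mem_open_iff (isOpen_basicOpen a))))⟩

theorem isCoherent_primeSpec : IsCoherent (PrimeSpec L) := by
  refine ⟨_, isTopologicalBasis_basicOpen, ?_, ?_⟩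
  · rintro _ ⟨a, rfl⟩
    exact isCompact_basicOpen a
  · rintro _ ⟨a, rfl⟩ _ ⟨b, rfl⟩
    exact ⟨a ⊓ b, basicOpen_inf a b⟩

/-- The generic point of an irreducible closed set `C` is the ideal of all `b` with `d b` disjoint
from `C`; the hypothesis on `a` is what makes this ideal nonempty. -/
theorem exists_closure_singleton_eq {C : Set (PrimeSpec L)} (hC : IsIrreducible C)
    (hCc : IsClosed C) {a : L} (ha : ¬ (basicOpen a ∩ C).Nonempty) :
    ∃ I : PrimeSpec L, closure {I} = C := by
  have hI : Order.IsIdeal {b : L | ¬ (basicOpen b ∩ C).Nonempty} := by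
    refine ⟨fun b c hcb hb hc => hb (hc.mono ?_), ⟨a, ha⟩, fun b hb c hc => ?_⟩
    · exact Set.inter_subset_inter_left _ (basicOpen_mono hcb)
    · refine ⟨b ⊔ c, ?_, le_sup_left, le_sup_right⟩
      rintro ⟨I, hI, hIC⟩
      rw [basicOpen_sup] at hI
      exact hI.elim (fun h => hb ⟨I, h, hIC⟩) fun h => hc ⟨I, h, hIC⟩
  have hmem : ∀ b : L, b ∉ hI.toIdeal → (C ∩ basicOpen b).Nonempty := fun b hb => by
    rw [Set.inter_comm]
    exact not_not.1 hb
  have hprop : hI.toIdeal.IsProper := by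
    obtain ⟨I, hIC⟩ := hC.1
    obtain ⟨b, hb⟩ := (Set.ne_univ_iff_exists_notMem _).1 I.isPrime.toIsProper.ne_univ
    exact Order.Ideal.isProper_of_notMem (p := b) fun h => h ⟨I, hb, hIC⟩
  have hprime : hI.toIdeal.IsPrime := by
    refine Order.Ideal.IsPrime.of_mem_or_mem ?_
    intro b c hbc
    by_contra hcon
    rw [not_or] at hcon
    obtain ⟨I, hIC, hIbc⟩ := hC.2 _ _ (isOpen_basicOpen b) (isOpen_basicOpen c)
      (hmem b hcon.1) (hmem c hcon.2)
    exact hbc ⟨I, by rwa [basicOpen_inf], hIC⟩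
  refine ⟨⟨hI.toIdeal, hprime⟩, (closure_singleton_eq_iff isTopologicalBasis_basicOpen hCc).2 ?_⟩
  rintro _ ⟨b, rfl⟩
  exact not_not

theorem isAlmostSober_primeSpec : IsAlmostSober (PrimeSpec L) := by
  intro F hF hc hne
  obtain ⟨I, hI⟩ := (Set.ne_univ_iff_exists_notMem _).1 hne
  obtain ⟨_, ⟨a, rfl⟩, -, ha⟩ :=
    isTopologicalBasis_basicOpen.exists_subset_of_mem_open hI hc.isOpen_compl
  exact exists_closure_singleton_eq hF hc (a := a) fun h => h.elim fun _ hJ => ha hJ.1 hJ.2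

theorem basicOpen_eq_empty_iff {a : L} : basicOpen a = ∅ ↔ IsBot a := by
  refine ⟨isBot_of_basicOpen_eq_empty, fun h => Set.eq_empty_of_forall_notMem fun I hI => ?_⟩
  obtain ⟨x, hx⟩ := I.1.nonempty
  exact hI (I.1.lower (h x) hx)

/-- Without a minimum, every basic open set is nonempty, so the whole spectrum is irreducible; a
generic point would be a prime ideal with no elements. -/
theorem isSober_primeSpec_iff [Nonempty L] : IsSober (PrimeSpec L) ↔ ∃ a : L, IsBot a := by
  constructor
  · intro hs
    by_contra! hbot
    have hne : ∀ a : L, (basicOpen a).Nonempty := fun a =>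
      Set.nonempty_iff_ne_empty.2 fun h => hbot a (basicOpen_eq_empty_iff.1 h)
    have hirr : IsIrreducible (Set.univ : Set (PrimeSpec L)) := by
      refine ⟨(hne (Classical.arbitrary L)).mono (Set.subset_univ _), ?_⟩
      rintro U V hU hV ⟨_, -, hIU⟩ ⟨_, -, hJV⟩
      obtain ⟨_, ⟨a, rfl⟩, -, ha⟩ :=
        isTopologicalBasis_basicOpen.exists_subset_of_mem_open hIU hU
      obtain ⟨_, ⟨b, rfl⟩, -, hb⟩ :=
        isTopologicalBasis_basicOpen.exists_subset_of_mem_open hJV hV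
      obtain ⟨K, hK⟩ := hne (a ⊓ b)
      rw [basicOpen_inf] at hK
      exact ⟨K, Set.mem_univ K, ha hK.1, hb hK.2⟩
    obtain ⟨I, hI, -⟩ := hs _ hirr isClosed_univ
    obtain ⟨x, hx⟩ := I.1.nonempty
    refine ((closure_singleton_eq_iff isTopologicalBasis_basicOpen isClosed_univ).1 hI
      (basicOpen x) ⟨x, rfl⟩).2 ?_ hx
    simpa using hne x
  · rintro ⟨a, ha⟩
    refine isSober_of_exists fun F hF hc => exists_closure_singleton_eq hF hc (a := a) ?_
    simp [basicOpen_eq_empty_iff.2 ha]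

end Spec

/-! ### Up-spectral and down-spectral spaces among Balbes-Dwinger spaces -/

section Characterization

variable {X : Type u} [TopologicalSpace X]

theorem IsBalbesDwinger.t0Space (hX : IsBalbesDwinger X) : T0Space X := by
  obtain ⟨L, iL, nL, ⟨e⟩⟩ := hX
  exact e.symm.t0Space

theorem IsBalbesDwinger.isCoherent (hX : IsBalbesDwinger X) : IsCoherent X := by
  obtain ⟨L, iL, nL, ⟨e⟩⟩ := hX
  exact isCoherent_primeSpec.of_homeomorph e

theorem IsBalbesDwinger.isAlmostSober (hX : IsBalbesDwinger X) : IsAlmostSober X := by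
  obtain ⟨L, iL, nL, ⟨e⟩⟩ := hX
  exact isAlmostSober_primeSpec.of_homeomorph e

theorem isUpSpectral_iff : IsUpSpectral X ↔ IsBalbesDwinger X ∧ IsSober X :=
  ⟨fun h => ⟨h.isBalbesDwinger, h.2⟩, fun h => ⟨h.1.isCoherent, h.2⟩⟩

theorem isDownSpectral_iff : IsDownSpectral X ↔ IsBalbesDwinger X ∧ CompactSpace X :=
  ⟨fun h => ⟨h.isBalbesDwinger, h.2.2.1⟩,
    fun h => ⟨h.1.t0Space, h.1.isCoherent, h.2, h.1.isAlmostSober⟩⟩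

theorem isUpSpectral_primeSpec_iff {L : Type u} [DistribLattice L] [Nonempty L] :
    IsUpSpectral (PrimeSpec L) ↔ ∃ a : L, IsBot a :=
  (and_iff_right isCoherent_primeSpec).trans isSober_primeSpec_iff

/-- Coherence and almost-sobriety hold on every spectrum, so only compactness matters; a compact
nonempty spectrum is itself a basic open set `d t`, and `t` is then the maximum. -/
theorem isDownSpectral_primeSpec_iff {L : Type u} [DistribLattice L] [Nonempty L] :
    IsDownSpectral (PrimeSpec L) ↔ ∃ a : L, IsTop a := by
  constructor
  · rintro ⟨-, -, hc, -⟩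
    rcases isEmpty_or_nonempty (PrimeSpec L) with h | h
    · -- prime ideals separate elements, so here `L` has a single element
      refine ⟨Classical.arbitrary L, fun b => ?_⟩
      by_contra hb
      obtain ⟨I, -⟩ := exists_prime hb
      exact isEmptyElim I
    · obtain ⟨t, ht⟩ := exists_basicOpen_eq
        (A := (Set.univ : Set (PrimeSpec L))) ⟨Set.univ_nonempty, isOpen_univ, isCompact_univ⟩
      refine ⟨t, fun b => ?_⟩
      by_contra hb
      obtain ⟨I, hI, -⟩ := exists_prime hb
      exact (ht.symm ▸ Set.mem_univ I : I ∈ basicOpen t) hI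
  · rintro ⟨t, ht⟩
    have hu : basicOpen t = Set.univ := Set.eq_univ_iff_forall.2 fun I hI =>
      I.isPrime.toIsProper.ne_univ (Set.eq_univ_iff_forall.2 fun x => I.1.lower (ht x) hI)
    exact ⟨inferInstance, isCoherent_primeSpec, ⟨hu ▸ isCompact_basicOpen t⟩,
      isAlmostSober_primeSpec⟩

/-! ### The duality -/

/-- A Balbes-Dwinger space is the spectrum of its lattice of fundamental sets. -/
noncomputable def homeomorphSpecFund (hX : IsBalbesDwinger X) :
    X ≃ₜ PrimeSpec (fundamentalSets X hX) :=
  haveI := hX.t0Space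
  homeomorphPrimeSpec (fundamentalSets X hX)
    (by
      obtain ⟨L, iL, nL, e, he⟩ := hX.exists_iff
      convert isTopologicalBasis_basicOpen.isInducing e.isInducing
      ext A
      exact (he A).trans (by simp))
    (fun x => by
      obtain ⟨L, iL, nL, e, he⟩ := hX.exists_iff
      obtain ⟨a, ha⟩ := (e x).1.nonempty
      exact ⟨e ⁻¹' basicOpen a, (he _).2 ⟨a, rfl⟩, fun h => h ha⟩)
    fun P => exists_point hX P.1 P.2

theorem basicOpen_subset_basicOpen_iff {L : Type u} [DistribLattice L] {a b : L} :
    basicOpen a ⊆ basicOpen b ↔ a ≤ b := by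
  refine ⟨fun h => ?_, basicOpen_mono⟩
  by_contra hab
  obtain ⟨I, hb, ha⟩ := exists_prime hab
  exact h ha hb

/-- A distributive lattice is the lattice of fundamental sets of its spectrum, by `a ↦ d a`. -/
noncomputable def orderIsoFundSpec (L : Type u) [DistribLattice L] [Nonempty L]
    (hX : IsBalbesDwinger (PrimeSpec L)) : L ≃o fundamentalSets (PrimeSpec L) hX where
  toEquiv := Equiv.ofBijective (fun a => ⟨basicOpen a, isFundamental_iff.2 ⟨a, rfl⟩⟩)
    ⟨fun _ _ h => le_antisymm (basicOpen_subset_basicOpen_iff.1 (Subtype.ext_iff.1 h).le)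
        (basicOpen_subset_basicOpen_iff.1 (Subtype.ext_iff.1 h).ge),
      fun A => (isFundamental_iff.1 A.2).imp fun _ h => Subtype.ext h⟩
  map_rel_iff' := basicOpen_subset_basicOpen_iff

end Characterization

/-! ### The categorical equivalence -/

section Categories

theorem isProperHom_orderIso {L M : Type u} [DistribLattice L] [DistribLattice M] (e : L ≃o M) :
    IsProperHom (e : LatticeHom L M) := by
  intro P hP
  have hI : Order.IsIdeal {a : L | e a ∈ P} := by
    refine ⟨fun a b hba ha => P.lower (e.monotone hba) ha, ?_, fun a ha b hb => ?_⟩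
    · obtain ⟨y, hy⟩ := P.nonempty
      exact ⟨e.symm y, by simpa using hy⟩
    · refine ⟨a ⊔ b, ?_, le_sup_left, le_sup_right⟩
      change e (a ⊔ b) ∈ P
      rw [map_sup]
      exact Order.Ideal.sup_mem ha hb
  have hprop : hI.toIdeal.IsProper := by
    obtain ⟨y, hy⟩ := (Set.ne_univ_iff_exists_notMem _).1 hP.toIsProper.ne_univ
    exact Order.Ideal.isProper_of_notMem (p := e.symm y) fun h => hy (by simpa using h)
  refine ⟨hI.toIdeal, Order.Ideal.IsPrime.of_mem_or_mem fun {a b} hab => ?_, rfl⟩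
  have hab' : e (a ⊓ b) ∈ P := hab
  rw [map_inf] at hab'
  exact hP.mem_or_mem hab'

/-- An order isomorphism is an isomorphism in the category of proper homomorphisms. -/
def DLat.isoOfOrderIso {L M : DLat.{u}} (e : L.carrier ≃o M.carrier) : L ≅ M where
  hom := ⟨e, isProperHom_orderIso e⟩
  inv := ⟨e.symm, isProperHom_orderIso e.symm⟩
  hom_inv_id := DLat.Hom.ext (LatticeHom.ext e.symm_apply_apply)
  inv_hom_id := DLat.Hom.ext (LatticeHom.ext e.apply_symm_apply)

theorem StronglyContinuous.of_homeomorph {X Y : Type u} [TopologicalSpace X] [TopologicalSpace Y]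
    (e : X ≃ₜ Y) : StronglyContinuous e :=
  ⟨e.continuous, fun _ hA => hA.preimage_homeomorph e⟩

/-- A homeomorphism is an isomorphism in the category of strongly continuous maps. -/
def BDSpace.isoOfHomeomorph {X Y : BDSpace.{u}} (e : X.carrier ≃ₜ Y.carrier) : X ≅ Y where
  hom := ⟨e, .of_homeomorph e⟩
  inv := ⟨e.symm, .of_homeomorph e.symm⟩
  hom_inv_id := BDSpace.Hom.ext (funext e.symm_apply_apply)
  inv_hom_id := BDSpace.Hom.ext (funext e.apply_symm_apply)

/-- The homeomorphism underlying an isomorphism of Balbes-Dwinger spaces. -/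
def BDSpace.homeomorphOfIso {X Y : BDSpace.{u}} (i : X ≅ Y) : X.carrier ≃ₜ Y.carrier where
  toFun := i.hom.toFun
  invFun := i.inv.toFun
  left_inv x := congrFun (congrArg BDSpace.Hom.toFun i.hom_inv_id) x
  right_inv y := congrFun (congrArg BDSpace.Hom.toFun i.inv_hom_id) y
  continuous_toFun := i.hom.stronglyContinuous.continuous
  continuous_invFun := i.inv.stronglyContinuous.continuous

instance : upSpectral.{u}.IsClosedUnderIsomorphisms where
  of_iso {_ Y} i h :=
    ⟨Y.isBalbesDwinger.isCoherent, h.2.of_homeomorph (BDSpace.homeomorphOfIso i).symm⟩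

instance : downSpectral.{u}.IsClosedUnderIsomorphisms where
  of_iso {_ Y} i h := by
    have := h.2.2.1
    exact isDownSpectral_iff.2 ⟨Y.isBalbesDwinger, (BDSpace.homeomorphOfIso i).compactSpace⟩

/-- The duality between distributive lattices and Balbes-Dwinger spaces, with `specFunctor` and
`fundFunctor.rightOp` as its two functors on the nose. -/
noncomputable def specFundEquivalence : DLat.{u}ᵒᵖ ≌ BDSpace.{u} :=
  CategoryTheory.Equivalence.mk specFunctor fundFunctor.rightOp
    -- both families of isomorphisms are natural in the direction given by the canonical maps
    -- `a ↦ d a` and `x ↦ {A | x ∉ A}`, and are inverted to fit the unit and the counit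
    (NatIso.ofComponents (F := specFunctor ⋙ fundFunctor.rightOp) (G := 𝟭 _)
      (fun L => (DLat.isoOfOrderIso (orderIsoFundSpec L.unop.carrier
        (specFunctor.obj L).isBalbesDwinger)).op)
      fun f => Quiver.Hom.unop_inj (DLat.Hom.ext (LatticeHom.ext fun a => by
        exact Subtype.ext (specMap_preimage f.unop.hom f.unop.isProper a)))).symm
    (NatIso.ofComponents (F := 𝟭 _) (G := fundFunctor.rightOp ⋙ specFunctor)
      (fun X => BDSpace.isoOfHomeomorph (homeomorphSpecFund X.isBalbesDwinger))
      fun {X Y} f => BDSpace.Hom.ext (funext fun x =>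
        PrimeSpec.ext (Order.Ideal.ext (Set.ext fun _ => by
          exact (mem_specMap (hh := isProperHom_fundMap X.isBalbesDwinger Y.isBalbesDwinger f.toFun
            f.stronglyContinuous) (I := homeomorphSpecFund X.isBalbesDwinger x)).symm)))).symm

end Categories

end BalbesDwinger

theorem mainTheorem6 :
    (∀ (X : Type u) [TopologicalSpace X],
      (BalbesDwinger.IsUpSpectral X ↔
        BalbesDwinger.IsBalbesDwinger X ∧ BalbesDwinger.IsSober X) ∧
      (BalbesDwinger.IsDownSpectral X ↔
        BalbesDwinger.IsBalbesDwinger X ∧ CompactSpace X)) ∧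
    (∃ e : BalbesDwinger.latWithMin.{u}.FullSubcategoryᵒᵖ ≌
          BalbesDwinger.upSpectral.{u}.FullSubcategory,
      e.functor ⋙ BalbesDwinger.upSpectral.ι =
        BalbesDwinger.latWithMin.ι.op ⋙ BalbesDwinger.specFunctor ∧
      e.inverse ⋙ BalbesDwinger.latWithMin.ι.op =
        BalbesDwinger.upSpectral.ι ⋙ BalbesDwinger.fundFunctor.rightOp) ∧
    (∃ e : BalbesDwinger.latWithMax.{u}.FullSubcategoryᵒᵖ ≌
          BalbesDwinger.downSpectral.{u}.FullSubcategory,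
      e.functor ⋙ BalbesDwinger.downSpectral.ι =
        BalbesDwinger.latWithMax.ι.op ⋙ BalbesDwinger.specFunctor ∧
      e.inverse ⋙ BalbesDwinger.latWithMax.ι.op =
        BalbesDwinger.downSpectral.ι ⋙ BalbesDwinger.fundFunctor.rightOp) := by
  -- restriction to full subcategories does not change the values of the two functors, so the
  -- compatibilities with the inclusions hold by definition
  refine ⟨fun X _ => ⟨BalbesDwinger.isUpSpectral_iff, BalbesDwinger.isDownSpectral_iff⟩,
    ⟨BalbesDwinger.latWithMin.opEquivalence.symm.trans
      (BalbesDwinger.specFundEquivalence.congrFullSubcategory (P := BalbesDwinger.latWithMin.op)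
        (Q := BalbesDwinger.upSpectral) ?_), rfl, rfl⟩,
    ⟨BalbesDwinger.latWithMax.opEquivalence.symm.trans
      (BalbesDwinger.specFundEquivalence.congrFullSubcategory (P := BalbesDwinger.latWithMax.op)
        (Q := BalbesDwinger.downSpectral) ?_), rfl, rfl⟩⟩
  · exact funext fun _ => propext BalbesDwinger.isUpSpectral_primeSpec_iff
  · exact funext fun _ => propext BalbesDwinger.isDownSpectral_primeSpec_iff
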